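/- Conventions. A homomorphism of groups $n\colon M\to G$ is a *normal map* if it carries a crossed module structure, i.e. there is an action of $G$ on $M$ by automorphisms with $n(g\cdot m)=g\,n(m)\,g^{-1}$ and $n(m)\cdot m'=m\,m'\,m^{-1}$ for all $g\in G$, $m,m'\in M$. A *subnormal map* is a homomorphism that is a composite of a finite series of normal maps. The *free normal closure* of a homomorphism $\varphi\colon\Gamma\to G$ is the universal factorization $\Gamma\to\Gamma^{\varphi}\to G$ of $\varphi$ through a crossed module over $G$; explicitly, $\Gamma^{\varphi}$ is the quotient of the free product of copies ${}^{g}\Gamma$ of $\Gamma$ indexed by $g\in G$, mapped to $G$ by $\partial({}^{g}\gamma)=g\varphi(\gamma)g^{-1}$ and acted on by $h\cdot{}^{g}\gamma={}^{hg}\gamma$, by the normal closure of all elements $x\,y\,x^{-1}(\partial x\cdot y)^{-1}$, with $\Gamma\to\Gamma^{\varphi}$ given by $\gamma\mapsto{}^{1}\gamma$. The *normal closures tower* of $\varphi$ is defined by $\Gamma_1=G$, $\varphi_1=\varphi$, $\Gamma_{i+1}=\Gamma_i^{\varphi_i}$, with $\varphi_{i+1}\colon\Gamma\to\Gamma_{i+1}$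 and $\Gamma_{i+1}\to\Gamma_i$ the canonical maps. Let $\Gamma_{\infty,\varphi}=\varprojlim_i\Gamma_i$, let $\varphi_\infty\colon\Gamma\to\Gamma_{\infty,\varphi}$ be the map induced by the $\varphi_i$, and let $l\colon\Gamma_{\infty,\varphi}\to\Gamma_1=G$ be the projection. **Theorem.** Let $\varphi\colon\Gamma\to G$ be a homomorphism of finite groups. Then $\Gamma\xrightarrow{\varphi_\infty}\Gamma_{\infty,\varphi}\xrightarrow{l}G$ is the initial factorization of $\varphi$ among all factorizations of $\varphi$ whose second map is subnormal. That is, $l\circ\varphi_\infty=\varphi$, the map $l$ is subnormal, and for every group $S$ (finite or not) and all homomorphisms $\psi\colon\Gamma\to S$ and $s\colon S\to G$ with $s\circ\psi=\varphi$ and $s$ subnormal, there is exactly one homomorphism $\sigma\colon\Gamma_{\infty,\varphi}\to S$ with $\sigma\circ\varphi_\infty=\psi$ and $s\circ\sigma=l$. -/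

import Mathlib

universe u

/-- A normal structure on `n : M →* G`, i.e. a crossed module structure: an action of `G` on `M` by
group automorphisms with `n (g • m) = g * n m * g⁻¹` and `n m • m' = m * m' * m⁻¹`. -/
structure NormalStructure {M G : Type u} [Group M] [Group G] (n : M →* G) where
  /-- the action of `G` on `M` -/
  act : G →* MulAut M
  equivariant : ∀ (g : G) (m : M), n (act g m) = g * n m * g⁻¹
  peiffer : ∀ m m' : M, act (n m) m' = m * m' * m⁻¹

/-- A homomorphism is a normal map if it carries a crossed module structure. -/
def IsNormalMap {M G : Type u} [Group M] [Group G] (n : M →* G) : Prop :=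
  Nonempty (NormalStructure n)

/-- A homomorphism to `G` is a subnormal map if it is the composite of a finite series
`M_{k+1} → M_k → ⋯ → M_2 → M_1 = G` of normal maps. (The empty series gives the identity of `G`,
which is itself a normal map.) -/
inductive IsSubnormalMap {G : Type u} [Group G] :
    ∀ {M : Type u} [Group M], (M →* G) → Prop
  | id : IsSubnormalMap (MonoidHom.id G)
  | comp {M N : Type u} [Group M] [Group N] (m : M →* G) (n : N →* M) :
      IsSubnormalMap m → IsNormalMap n → IsSubnormalMap (m.comp n)

namespace FreeNormalClosure

section

variable {Γ G : Type u} [Group Γ] [Group G] (φ : Γ →* G)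

variable (Γ G) in
/-- The free product of copies of `Γ` indexed by the elements of `G`; the copy of `γ` with index
`g` stands for the formal conjugate `g γ g⁻¹`. -/
abbrev Pre : Type u := Monoid.CoprodI (fun _ : G => Γ)

/-- The formal conjugate of `γ` by `g`. -/
def formalConj (g : G) : Γ →* Pre Γ G := Monoid.CoprodI.of (M := fun _ : G => Γ) (i := g)

/-- The action of `h : G` on the free product: it permutes the copies of `Γ` by `g ↦ h * g`. -/
def translate (h : G) : Pre Γ G →* Pre Γ G :=
  Monoid.CoprodI.lift (fun g : G => formalConj (h * g))

/-- The homomorphism to `G` that sends the formal conjugate of `γ` by `g` to `g * φ γ * g⁻¹`. -/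
def preBoundary : Pre Γ G →* G :=
  Monoid.CoprodI.lift (fun g : G => (MulAut.conj g).toMonoidHom.comp φ)

/-- The Peiffer elements `x * y * x⁻¹ * (∂x • y)⁻¹`. -/
def peifferSet : Set (Pre Γ G) :=
  {z | ∃ x y : Pre Γ G, z = x * y * x⁻¹ * (translate (preBoundary φ x) y)⁻¹}

theorem preBoundary_translate (h : G) (y : Pre Γ G) :
    preBoundary φ (translate h y) = h * preBoundary φ y * h⁻¹ := by
  have key : (preBoundary φ).comp (translate h) =
      (MulAut.conj h).toMonoidHom.comp (preBoundary φ) := by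
    refine Monoid.CoprodI.ext_hom _ _ (fun g => ?_)
    ext γ
    simp [preBoundary, translate, formalConj, mul_assoc]
  simpa using DFunLike.congr_fun key y

end

end FreeNormalClosure

open FreeNormalClosure in
/-- The free normal closure `Γ^φ` of `φ : Γ →* G`: the quotient of the free product of the formal
conjugates of `Γ` by the Peiffer relations. -/
def FreeNormalClosure {Γ G : Type u} [Group Γ] [Group G] (φ : Γ →* G) : Type u :=
  Pre Γ G ⧸ Subgroup.normalClosure (peifferSet φ)

namespace FreeNormalClosure

section

variable {Γ G : Type u} [Group Γ] [Group G] (φ : Γ →* G)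

instance : Group (FreeNormalClosure φ) :=
  inferInstanceAs (Group (Pre Γ G ⧸ Subgroup.normalClosure (peifferSet φ)))

/-- The canonical homomorphism `c_φ : Γ →* Γ^φ`. -/
def unit : Γ →* FreeNormalClosure φ :=
  (QuotientGroup.mk' (Subgroup.normalClosure (peifferSet φ))).comp (formalConj 1)

theorem normalClosure_le_ker :
    Subgroup.normalClosure (peifferSet φ) ≤ (preBoundary φ).ker := by
  refine Subgroup.normalClosure_le_normal ?_
  rintro _ ⟨x, y, rfl⟩
  simp [MonoidHom.mem_ker, preBoundary_translate, mul_assoc]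

/-- The canonical homomorphism `Γ^φ →* G`; its composite with `c_φ` is `φ`. -/
def boundary : FreeNormalClosure φ →* G :=
  QuotientGroup.lift (Subgroup.normalClosure (peifferSet φ)) (preBoundary φ)
    (fun _ hx => normalClosure_le_ker φ hx)

theorem boundary_unit (γ : Γ) : boundary φ (unit φ γ) = φ γ := by
  change preBoundary φ (formalConj 1 γ) = φ γ
  simp [preBoundary, formalConj]

end

end FreeNormalClosure

/-- A group together with a homomorphism from `Γ`. -/
structure GroupUnder (Γ : Type u) [Group Γ] where
  /-- the group -/
  carrier : Type u
  /-- its group structure -/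
  [group : Group carrier]
  /-- the homomorphism from `Γ` -/
  hom : Γ →* carrier

attribute [instance] GroupUnder.group

namespace NormalClosuresTower

section

variable {Γ G : Type u} [Group Γ] [Group G] (φ : Γ →* G)

/-- The normal closures tower of `φ`, with indices starting at `0`: `stage φ 0` is `φ : Γ →* G`,
and `stage φ (i + 1)` is the free normal closure of `stage φ i` with its canonical homomorphism
from `Γ`. -/
def stage : ℕ → GroupUnder Γ
  | 0 => ⟨G, φ⟩
  | i + 1 => ⟨FreeNormalClosure (stage i).hom, FreeNormalClosure.unit (stage i).hom⟩

/-- The normal map from each stage of the tower to the preceding one. -/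
def down (i : ℕ) : (stage φ (i + 1)).carrier →* (stage φ i).carrier :=
  FreeNormalClosure.boundary (stage φ i).hom

/-- The inverse limit `Γ_∞` of the tower, as a group of compatible sequences. -/
def limit : Subgroup (∀ i, (stage φ i).carrier) where
  carrier := {x | ∀ i, down φ i (x (i + 1)) = x i}
  one_mem' i := map_one _
  mul_mem' {x y} hx hy i := by
    rw [Pi.mul_apply, Pi.mul_apply, map_mul, hx i, hy i]
  inv_mem' {x} hx i := by
    rw [Pi.inv_apply, Pi.inv_apply, map_inv, hx i]

/-- The natural homomorphism `φ_∞ : Γ →* Γ_∞`. -/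
def toLimit : Γ →* limit φ :=
  (MonoidHom.pi (fun i => (stage φ i).hom)).codRestrict (limit φ)
    (fun γ i => FreeNormalClosure.boundary_unit (stage φ i).hom γ)

/-- The natural homomorphism `Γ_∞ →* G`, the projection to the bottom of the tower. -/
def fromLimit : limit φ →* G :=
  (Pi.evalMonoidHom (fun i => (stage φ i).carrier) 0).comp (limit φ).subtype

end

end NormalClosuresTower

/-! ### Bounding a finite group by its hypercentral index and a normally generating subgroup. -/

namespace Subgroup

open scoped commutatorElement

/-! Existence of `σ` is formal: the universal property of free normal closures, applied once per
normal map in the series for `s`, gives a map from some stage to `S`. Uniqueness holds because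
normal maps have central kernels and `Γ` normally generates the limit.

The real content is that the tower's limit is reached at a finite level. All stages are finite, so
in each one the images of the higher stages stabilize. These stable images are normally generated by
`Γ` and form a tower of surjections with central kernels; hence the `i`-th upper central term of the
`i`-th one has index at most `|G|` (`index_upperCentralSeries_stableImage_le`). By
`card_le_of_normalClosure_range_eq_top` their orders are then bounded, so the surjections are
eventually isomorphisms and the limit is one of the stable images. It maps to `G` by finitely many
central extensions followed by the inclusion of a subnormal subgroup.

For the order bound, let `L = [L, A]` be the last lower central term. The quotient `A / L` is
nilpotent, hence a quotient of `Γ`. Since `L` centralizes the hypercentral term, Schur's theorem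
bounds `[L, L]`; the abelianization of `L` has bounded exponent and rank. -/

theorem exists_antitone_eventually_eq {A : Type*} [Group A] [Finite A]
    {f : ℕ → Subgroup A} (hf : Antitone f) : ∃ n, ∀ m, n ≤ m → f m = f n := by
  obtain ⟨n, hn⟩ := (wellFounded_lt (α := Subgroup A)).has_min (Set.range f) ⟨f 0, 0, rfl⟩
  obtain ⟨⟨n, rfl⟩, hmin⟩ := hn
  refine ⟨n, fun m hm => ?_⟩
  by_contra h
  exact hmin _ ⟨m, rfl⟩ (lt_of_le_of_ne (hf hm) h)

theorem comap_upperCentralSeries_le {A B : Type*} [Group A] [Group B] {f : A →* B}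
    (hf : f.ker ≤ center A) (i : ℕ) :
    (upperCentralSeries B i).comap f ≤ upperCentralSeries A (i + 1) := by
  induction i with
  | zero => exact hf.trans (upperCentralSeries_one A).ge
  | succ i ih =>
    intro x hx
    refine mem_upperCentralSeries_succ_iff.2 fun y => ih ?_
    have := mem_upperCentralSeries_succ_iff.1 (mem_comap.1 hx) (f y)
    simpa [mem_comap] using this

/-- A subgroup that, together with a term of the upper central series, generates the whole group
is subnormal, hence everything as soon as its normal closure is. -/
theorem eq_top_of_sup_upperCentralSeries_eq_top {A : Type*} [Group A] {H : Subgroup A}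
    (hH : normalClosure (H : Set A) = ⊤) {k : ℕ} (hk : H ⊔ upperCentralSeries A k = ⊤) :
    H = ⊤ := by
  induction k with
  | zero => simpa using hk
  | succ k ih =>
    refine ih ?_
    -- Write `a = b * z` with `b ∈ H` and `z` in term `k + 1`: conjugation by `z` alters `h` only by
    -- a commutator in term `k`.
    have hconj : ∀ h ∈ H, ∀ a : A, a * h * a⁻¹ ∈ H ⊔ upperCentralSeries A k := by
      intro h hh a
      have ha : a ∈ H ⊔ upperCentralSeries A (k + 1) := hk ▸ mem_top a
      obtain ⟨b, hb, z, hz, rfl⟩ := mem_sup_of_normal_right.1 ha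
      have h1 := (mem_upperCentralSeries_succ_iff.1 hz) h
      have h2 : b * z * h * (b * z)⁻¹ = b * (z * h * z⁻¹ * h⁻¹) * b⁻¹ * (b * h * b⁻¹) := by group
      rw [h2]
      exact mul_mem (mem_sup_right (Normal.conj_mem inferInstance _ h1 b))
        (mem_sup_left (mul_mem (mul_mem hb hh) (inv_mem hb)))
    rw [← top_le_iff, ← hH, normalClosure, closure_le]
    intro x hx
    obtain ⟨h, hh, hx⟩ := Group.mem_conjugatesOfSet_iff.1 hx
    obtain ⟨a, rfl⟩ := isConj_iff.1 hx
    exact hconj h hh a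

/-- An equivariant homomorphism from a subgroup `L = [L, A]` into the hypercenter of a group
under `A` is trivial. -/
theorem equivariant_eq_one {A B : Type*} [Group A] [Group B] {L : Subgroup A} [L.Normal]
    (hL : L ≤ ⁅L, (⊤ : Subgroup A)⁆) (π : A →* B) (f : L →* B)
    (hf : ∀ (g : A) (x : L), f (MulAut.conjNormal g x) = π g * f x * (π g)⁻¹) {k : ℕ}
    (hk : ∀ x, f x ∈ upperCentralSeries B k) : f = 1 := by
  induction k with
  | zero => ext x; simpa using hk x
  | succ k ih =>
    refine ih ?_
    -- The commutators `⁅x, g⁆` generate `L`, and `f` sends them to `⁅f x, π g⁆`, one term lower.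
    have hle : L ≤ ((upperCentralSeries B k).comap f).map L.subtype := by
      refine hL.trans ?_
      rw [commutator_le]
      intro x hx g _
      refine ⟨⟨x, hx⟩ * (MulAut.conjNormal g ⟨x, hx⟩)⁻¹, ?_, ?_⟩
      · change f _ ∈ upperCentralSeries B k
        rw [map_mul, map_inv, hf]
        have := (mem_upperCentralSeries_succ_iff.1 (hk ⟨x, hx⟩)) (π g)
        convert this using 1
        group
      · simp [commutatorElement_def, mul_assoc]
    intro x
    obtain ⟨y, hy, hxy⟩ := hle x.2
    have : y = x := Subtype.ext hxy
    exact this ▸ hy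

/-- For `z` in term `k + 1`, induction makes `x ↦ ⁅x, z⁆` an equivariant homomorphism from `L` into
term `k`, so `equivariant_eq_one` kills it. -/
theorem commute_of_mem_upperCentralSeries {A : Type*} [Group A] {L : Subgroup A}
    [L.Normal] (hL : L ≤ ⁅L, (⊤ : Subgroup A)⁆) {k : ℕ} {z : A}
    (hz : z ∈ upperCentralSeries A k) {x : A} (hx : x ∈ L) : x * z = z * x := by
  induction k generalizing z x with
  | zero =>
    have : z = 1 := by simpa using hz
    simp [this]
  | succ k ih =>
    have hmem : ∀ y : A, y * z * y⁻¹ * z⁻¹ ∈ upperCentralSeries A k := by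
      intro y
      have := inv_mem ((mem_upperCentralSeries_succ_iff.1 hz) y)
      convert this using 1
      group
    let f : L →* A :=
      { toFun := fun x => x * z * (x : A)⁻¹ * z⁻¹
        map_one' := by simp
        map_mul' := by
          intro x y
          have h1 := ih (hmem y) x.2
          have h2 : (y : A) * z * (y : A)⁻¹ * z⁻¹ ∈ L := by
            have := mul_mem y.2 ((inferInstance : L.Normal).conj_mem _ (inv_mem y.2) z)
            simpa [mul_assoc] using this
          have h3 := ih (hmem x) h2
          calc ((x * y : L) : A) * z * ((x * y : L) : A)⁻¹ * z⁻¹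
              = (x * (y * z * (y : A)⁻¹ * z⁻¹)) * z * (x : A)⁻¹ * z⁻¹ := by
                simp [mul_assoc]
            _ = (y * z * (y : A)⁻¹ * z⁻¹) * (x * z * (x : A)⁻¹ * z⁻¹) := by
                rw [h1]; group
            _ = _ := h3 }
    have hf1 : f = 1 := by
      refine equivariant_eq_one hL (MonoidHom.id A) f ?_ (k := k)
        (fun y => hmem y)
      intro g x
      change (g * x * g⁻¹) * z * (g * x * g⁻¹)⁻¹ * z⁻¹ = g * (x * z * (x : A)⁻¹ * z⁻¹) * g⁻¹
      -- Equivariance amounts to replacing `z` by `g⁻¹ * z * g`, which differs from it by an element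
      -- of term `k`; by induction `x` commutes with that element.
      have hw : z⁻¹ * (g⁻¹ * z * g) ∈ upperCentralSeries A k := by
        have h1 := (inferInstance : (upperCentralSeries A k).Normal).conj_mem _ (hmem g⁻¹) z⁻¹
        convert h1 using 1
        group
      have hc := ih hw x.2
      calc (g * x * g⁻¹) * z * (g * x * g⁻¹)⁻¹ * z⁻¹
          = g * (x * z * (z⁻¹ * (g⁻¹ * z * g)) * (x : A)⁻¹ * (z⁻¹ * (g⁻¹ * z * g))⁻¹ * z⁻¹)
              * g⁻¹ := by group
        _ = g * (x * z * (x : A)⁻¹ * (x * (z⁻¹ * (g⁻¹ * z * g))) * (x : A)⁻¹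
              * (z⁻¹ * (g⁻¹ * z * g))⁻¹ * z⁻¹) * g⁻¹ := by group
        _ = _ := by rw [hc]; group
    have h1 : x * z * x⁻¹ * z⁻¹ = 1 := DFunLike.congr_fun hf1 ⟨x, hx⟩
    rw [mul_inv_eq_one, mul_inv_eq_iff_eq_mul] at h1
    exact h1

/-- Commutators are unchanged when their entries are multiplied by central elements. -/
theorem exists_surjective_commutatorSet (L : Type*) [Group L] :
    ∃ f : (L ⧸ center L) × (L ⧸ center L) → commutatorSet L, Function.Surjective f := by
  refine ⟨fun q => ⟨⁅(q.1.out : L), (q.2.out : L)⁆, q.1.out, q.2.out, rfl⟩, ?_⟩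
  rintro ⟨_, a, b, rfl⟩
  refine ⟨(a, b), Subtype.ext ?_⟩
  obtain ⟨y, hy⟩ := QuotientGroup.mk_out_eq_mul (center L) a
  obtain ⟨z, hz⟩ := QuotientGroup.mk_out_eq_mul (center L) b
  have h1 := fun g => mem_center_iff.1 y.2 g
  have h2 := fun g => mem_center_iff.1 z.2 g
  change ⁅(a : L ⧸ center L).out, (b : L ⧸ center L).out⁆ = ⁅a, b⁆
  rw [hy, hz, commutatorElement_def, commutatorElement_def]
  calc a * y * (b * z) * (a * y)⁻¹ * (b * z)⁻¹
      = a * (y * (b * z) * (y : L)⁻¹) * a⁻¹ * (b * z)⁻¹ := by group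
    _ = a * (b * z) * a⁻¹ * (b * z)⁻¹ := by rw [← h1 (b * z)]; group
    _ = a * b * (z * a⁻¹ * (z : L)⁻¹) * b⁻¹ := by group
    _ = a * b * a⁻¹ * b⁻¹ := by rw [← h2]; group

/-- A quantitative form of Schur's theorem. -/
theorem card_commutator_le_of_index_center_le {L : Type*} [Group L] [Finite L] {m : ℕ}
    (hm : (center L).index ≤ m) : Nat.card (_root_.commutator L) ≤ m ^ (m * (m * m) + 1) := by
  have hpos : 0 < (center L).index := Nat.pos_of_ne_zero FiniteIndex.index_ne_zero
  have hcard : Nat.card (commutatorSet L) ≤ m * m := by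
    obtain ⟨f, hf⟩ := exists_surjective_commutatorSet L
    have := Nat.card_le_card_of_surjective f hf
    rw [Nat.card_prod] at this
    exact this.trans (Nat.mul_le_mul hm hm)
  calc Nat.card (_root_.commutator L)
      ≤ (center L).index ^ ((center L).index * Nat.card (commutatorSet L) + 1) :=
        Nat.le_of_dvd (pow_pos hpos _) (card_commutator_dvd_index_center_pow L)
    _ ≤ m ^ ((center L).index * Nat.card (commutatorSet L) + 1) := Nat.pow_le_pow_left hm _
    _ ≤ _ := Nat.pow_le_pow_right (hpos.trans_le hm) (by gcongr)

/-- Conjugates of the image of `Γ` by coset representatives of `Z` suffice: together with `Z` they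
generate `A`, and `Z` can then be dropped. -/
theorem rank_le_of_normalClosure_range_eq_top {Γ A : Type*} [Group Γ] [Finite Γ] [Group A]
    [Finite A] (φ : Γ →* A) (hφ : normalClosure (Set.range φ) = ⊤) (k : ℕ) :
    Group.rank A ≤ (upperCentralSeries A k).index * Nat.card Γ := by
  classical
  set Z := upperCentralSeries A k
  have := Fintype.ofFinite Γ
  have := Fintype.ofFinite (A ⧸ Z)
  let c : (A ⧸ Z) × Γ → A := fun q => q.1.out * φ q.2 * q.1.out⁻¹
  have key : closure (Finset.univ.image c : Finset A) = (⊤ : Subgroup A) := by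
    have hc : ∀ (q : A ⧸ Z) (γ : Γ), q.out * φ γ * q.out⁻¹ ∈ closure ((Finset.univ.image c : Finset A) : Set A) :=
      fun q γ => subset_closure (by simpa using ⟨q, γ, rfl⟩)
    refine eq_top_of_sup_upperCentralSeries_eq_top (k := k) ?_ ?_
    · rw [← top_le_iff, ← hφ]
      refine normalClosure_le_normal ?_
      rintro _ ⟨γ, rfl⟩
      -- The representative of the trivial coset need not be `1`, so it is conjugated away.
      have h1 := subset_normalClosure (hc ((1 : A) : A ⧸ Z) γ)
      have h2 := (inferInstance : (normalClosure _).Normal).conj_mem _ h1 ((1 : A) : A ⧸ Z).out⁻¹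
      simpa [mul_assoc] using h2
    · rw [← top_le_iff, ← hφ, normalClosure, closure_le]
      intro x hx
      obtain ⟨_, ⟨γ, rfl⟩, hx⟩ := Group.mem_conjugatesOfSet_iff.1 hx
      obtain ⟨a, rfl⟩ := isConj_iff.1 hx
      obtain ⟨z, hz⟩ := QuotientGroup.mk_out_eq_mul Z a
      have h0 : (z : A) * ((φ γ)⁻¹ * (z : A)⁻¹ * (φ γ)) ∈ Z := by
        refine mul_mem z.2 ?_
        simpa using (inferInstance : Z.Normal).conj_mem _ (inv_mem z.2) (φ γ)⁻¹
      have h1 : a * φ γ * a⁻¹ = (a : A ⧸ Z).out * φ γ * (a : A ⧸ Z).out⁻¹ *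
          (a * (z * ((φ γ)⁻¹ * (z : A)⁻¹ * (φ γ))) * a⁻¹) := by
        rw [hz]; group
      rw [h1]
      exact mul_mem (mem_sup_left (hc (a : A ⧸ Z) γ))
        (mem_sup_right ((inferInstance : Z.Normal).conj_mem _ h0 a))
  refine (Group.rank_le key).trans (Finset.card_image_le.trans ?_)
  rw [Finset.card_univ, ← Nat.card_eq_fintype_card, Nat.card_prod, index_eq_card]


/-- The order of a finite group that is normally generated by the image of `Γ` is bounded in terms
of the order of `Γ` and the index of a term of the upper central series. -/
theorem card_le_of_normalClosure_range_eq_top {Γ A : Type*} [Group Γ] [Finite Γ] [Group A]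
    [Finite A] (φ : Γ →* A) (hφ : normalClosure (Set.range φ) = ⊤) {k m : ℕ}
    (hm : (upperCentralSeries A k).index = m) :
    Nat.card A ≤ Nat.card Γ * (m ^ (m * (m * m) + 1) * m ^ (Nat.card Γ * (m * Nat.card Γ))) := by
  have hm0 : 0 < m := hm ▸ Nat.pos_of_ne_zero FiniteIndex.index_ne_zero
  obtain ⟨n, hn⟩ := exists_antitone_eventually_eq
    (lowerCentralSeries_antitone (⊤ : Subgroup A))
  set L := (⊤ : Subgroup A).lowerCentralSeries n
  have hLnormal : L.Normal := inferInstance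
  have hL : L ≤ ⁅L, (⊤ : Subgroup A)⁆ := (hn (n + 1) n.le_succ).ge
  -- In the nilpotent group `A ⧸ L` a normally generating subgroup is everything, so `Γ` surjects
  -- onto it.
  have hindex : L.index ≤ Nat.card Γ := by
    have hnil : Group.IsNilpotent (A ⧸ L) := by
      refine nilpotent_iff_lowerCentralSeries.2 ⟨n, ?_⟩
      rw [← map_top_of_surjective _ (QuotientGroup.mk'_surjective L), ← map_lowerCentralSeries]
      exact (map_eq_bot_iff _).2 (by rw [QuotientGroup.ker_mk'])
    have hsurj : ((QuotientGroup.mk' L).comp φ).range = ⊤ := by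
      obtain ⟨k, hk⟩ := hnil.nilpotent
      refine eq_top_of_sup_upperCentralSeries_eq_top (k := k) ?_ (by simp [hk])
      have := map_normalClosure (Set.range φ) _ (QuotientGroup.mk'_surjective L)
      rw [hφ, map_top_of_surjective _ (QuotientGroup.mk'_surjective L)] at this
      rw [this, MonoidHom.coe_range, MonoidHom.coe_comp, Set.range_comp]
    rw [index_eq_card]
    exact Nat.card_le_card_of_surjective _ (MonoidHom.range_eq_top.1 hsurj)
  have hcomm : Nat.card (_root_.commutator L) ≤ m ^ (m * (m * m) + 1) := by
    refine card_commutator_le_of_index_center_le ?_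
    have hle : (upperCentralSeries A k).subgroupOf L ≤ center L := by
      intro z hz
      refine mem_center_iff.2 fun x => Subtype.ext ?_
      exact commute_of_mem_upperCentralSeries hL (mem_subgroupOf.1 hz) x.2
    calc (center L).index ≤ ((upperCentralSeries A k).subgroupOf L).index :=
          index_antitone hle
      _ ≤ m := Nat.le_of_dvd hm0 (hm ▸ relIndex_dvd_index_of_normal _ L)
  -- Modulo `[L, L]`, the map `x ↦ x ^ m` is an equivariant homomorphism; its values are
  -- hypercentral because `m` is the index of the hypercentral term. Hence it is trivial.
  have hpow : ∀ x : L, x ^ m ∈ _root_.commutator L := by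
    let K : Subgroup A := ⁅L, L⁆
    have hK : ∀ a b : L, Commute (QuotientGroup.mk' K a) (QuotientGroup.mk' K b) := by
      intro a b
      rw [← commutatorElement_eq_one_iff_commute, ← map_commutatorElement]
      exact (QuotientGroup.eq_one_iff _).2 (commutator_mem_commutator a.2 b.2)
    let f : L →* A ⧸ K :=
      { toFun := fun x => QuotientGroup.mk' K (x : A) ^ m
        map_one' := by simp
        map_mul' := fun x y => by
          rw [coe_mul, map_mul, (hK x y).mul_pow] }
    have hf : f = 1 := by
      refine equivariant_eq_one hL (QuotientGroup.mk' K) f ?_ (k := k) ?_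
      · intro g x
        change QuotientGroup.mk' K (MulAut.conjNormal g x : L) ^ m = _ * QuotientGroup.mk' K x ^ m * _
        rw [MulAut.conjNormal_apply, map_mul, map_mul, map_inv, conj_pow]
      · intro x
        refine upperCentralSeries.map (QuotientGroup.mk'_surjective K) k ?_
        refine ⟨(x : A) ^ m, ?_, map_pow _ _ _⟩
        rw [← hm]
        exact pow_index_mem _ _
    intro x
    have h1 : QuotientGroup.mk' K ((x : A) ^ m) = 1 := by
      rw [map_pow]; exact DFunLike.congr_fun hf x
    have h2 : (x : A) ^ m ∈ (_root_.commutator L).map L.subtype := by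
      rw [map_subtype_commutator]
      exact (QuotientGroup.eq_one_iff _).1 h1
    obtain ⟨y, hy, hxy⟩ := h2
    have : y = x ^ m := Subtype.ext (by simpa using hxy)
    exact this ▸ hy
  have hab : Nat.card (Abelianization L) ≤ m ^ (Nat.card Γ * (m * Nat.card Γ)) := by
    refine (Nat.le_of_dvd (pow_pos hm0 _)
      (card_dvd_exponent_pow_rank' (Abelianization L) (n := m) ?_)).trans
      (Nat.pow_le_pow_right hm0 ?_)
    · intro g
      obtain ⟨x, rfl⟩ := QuotientGroup.mk_surjective g
      exact (QuotientGroup.eq_one_iff _).2 (hpow x)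
    · calc Group.rank (Abelianization L) ≤ Group.rank L :=
            Group.rank_le_of_surjective Abelianization.of QuotientGroup.mk_surjective
        _ ≤ L.index * Group.rank A := rank_le_index_mul_rank L
        _ ≤ _ := Nat.mul_le_mul hindex
            (hm ▸ rank_le_of_normalClosure_range_eq_top φ hφ k)
  calc Nat.card A = L.index * Nat.card L := L.index_mul_card.symm
    _ = L.index * (Nat.card (_root_.commutator L) * Nat.card (Abelianization L)) := by
        congr 1
        exact ((_root_.commutator L).card_mul_index).symm
    _ ≤ _ := Nat.mul_le_mul hindex (Nat.mul_le_mul hcomm hab)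

end Subgroup

/-! ### Conjugate closures and finiteness of central extensions. -/

namespace Subgroup

/-- The subgroup generated by the conjugates of the image of `φ` by the elements of `H`. -/
def conjClosure {Γ A : Type*} [Group Γ] [Group A] (φ : Γ →* A) (H : Subgroup A) : Subgroup A :=
  closure {x | ∃ a ∈ H, ∃ γ, a * φ γ * a⁻¹ = x}

theorem conj_mem_conjClosure {Γ A : Type*} [Group Γ] [Group A] (φ : Γ →* A) {H : Subgroup A}
    {a : A} (ha : a ∈ H) (γ : Γ) : a * φ γ * a⁻¹ ∈ conjClosure φ H :=
  subset_closure ⟨a, ha, γ, rfl⟩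

theorem map_conjClosure {Γ A B : Type*} [Group Γ] [Group A] [Group B] (φ : Γ →* A)
    (H : Subgroup A) (f : A →* B) :
    (conjClosure φ H).map f = conjClosure (f.comp φ) (H.map f) := by
  rw [conjClosure, conjClosure, MonoidHom.map_closure]
  congr 1
  ext x
  constructor
  · rintro ⟨_, ⟨a, ha, γ, rfl⟩, rfl⟩
    exact ⟨f a, ⟨a, ha, rfl⟩, γ, by simp⟩
  · rintro ⟨_, ⟨a, ha, rfl⟩, γ, rfl⟩
    exact ⟨a * φ γ * a⁻¹, ⟨a, ha, γ, rfl⟩, by simp⟩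

theorem conj_mem_of_mem_conjClosure {Γ A : Type*} [Group Γ] [Group A] (φ : Γ →* A)
    {H : Subgroup A} {a x : A} (ha : a ∈ H) (hx : x ∈ conjClosure φ H) :
    a * x * a⁻¹ ∈ conjClosure φ H := by
  have : conjClosure φ H ≤ (conjClosure φ H).comap (MulAut.conj a).toMonoidHom := by
    refine (closure_le _).2 ?_
    rintro _ ⟨b, hb, γ, rfl⟩
    have := conj_mem_conjClosure φ (mul_mem ha hb) γ
    simpa [mul_assoc] using this
  exact this hx

/-- A group with a central kernel over a finite group is finite if it is generated by finitely
many elements of finite order. -/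
theorem finite_of_ker_le_center {E G : Type*} [Group E] [Group G] [Finite G] (f : E →* G)
    (hf : f.ker ≤ center E) {T : Set E} (hT : T.Finite) (htors : ∀ x ∈ T, IsOfFinOrder x)
    (hgen : closure T = ⊤) : Finite E := by
  have : (center E).FiniteIndex := finiteIndex_of_le hf
  -- Finitely many commutators make the commutator subgroup finite (Schur); the abelianization is
  -- finitely generated and torsion.
  have : Finite (commutatorSet E) := by
    obtain ⟨g, hg⟩ := exists_surjective_commutatorSet E
    exact Finite.of_surjective g hg
  have : Group.FG E := Group.fg_iff.2 ⟨T, hgen, hT⟩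
  have : Finite (Abelianization E) := by
    have : Group.FG (Abelianization E) :=
      Group.fg_of_surjective (f := Abelianization.of) QuotientGroup.mk_surjective
    refine CommGroup.finite_of_fg_isMulTorsion _ ?_
    intro x
    obtain ⟨y, rfl⟩ := QuotientGroup.mk_surjective x
    have hle : closure T ≤ (CommGroup.torsion (Abelianization E)).comap Abelianization.of :=
      (closure_le _).2 fun x hx => MonoidHom.isOfFinOrder _ (htors x hx)
    exact hle (hgen ▸ mem_top y)
  have : Finite (E ⧸ _root_.commutator E) := this
  exact Finite.of_subgroup_quotient (_root_.commutator E)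

end Subgroup

/-! ### The free normal closure: central kernel, finiteness, universal property. -/

namespace FreeNormalClosure

variable {Γ G : Type u} [Group Γ] [Group G] (φ : Γ →* G)

/-- The copy of `Γ` with index `g` in the free normal closure. -/
def copy (g : G) : Γ →* FreeNormalClosure φ :=
  (QuotientGroup.mk' (Subgroup.normalClosure (peifferSet φ))).comp (formalConj g)

theorem boundary_copy (g : G) (γ : Γ) : boundary φ (copy φ g γ) = g * φ γ * g⁻¹ := by
  change preBoundary φ (formalConj g γ) = _
  simp [preBoundary, formalConj]

theorem closure_range_copy :
    Subgroup.closure (Set.range fun p : G × Γ => copy φ p.1 p.2) = ⊤ := by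
  rw [eq_top_iff]
  intro x _
  obtain ⟨y, rfl⟩ := QuotientGroup.mk_surjective x
  induction y using Monoid.CoprodI.induction_on with
  | one => exact one_mem _
  | of g γ => exact Subgroup.subset_closure ⟨(g, γ), rfl⟩
  | mul x y hx hy => exact mul_mem (hx trivial) (hy trivial)

theorem translate_one (y : Pre Γ G) : translate 1 y = y := by
  have : translate (1 : G) = MonoidHom.id (Pre Γ G) := by
    refine Monoid.CoprodI.ext_hom _ _ fun g => ?_
    ext γ
    simp [translate, formalConj]
  exact DFunLike.congr_fun this y

/-- When `∂x = 1`, the Peiffer relation reads `x * y * x⁻¹ = y`. -/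
theorem ker_boundary_le_center : (boundary φ).ker ≤ Subgroup.center (FreeNormalClosure φ) := by
  intro x hx
  rw [Subgroup.mem_center_iff]
  intro y
  obtain ⟨x, rfl⟩ := QuotientGroup.mk_surjective x
  obtain ⟨y, rfl⟩ := QuotientGroup.mk_surjective y
  have hx : preBoundary φ x = 1 := hx
  refine QuotientGroup.eq.2 (Subgroup.subset_normalClosure ⟨x⁻¹, y⁻¹, ?_⟩)
  have hx : preBoundary φ x⁻¹ = 1 := by rw [map_inv, hx, inv_one]
  rw [hx, translate_one]
  group

theorem range_boundary : (boundary φ).range = Subgroup.conjClosure φ ⊤ := by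
  rw [MonoidHom.range_eq_map, ← closure_range_copy, MonoidHom.map_closure, Subgroup.conjClosure]
  congr 1
  ext x
  constructor
  · rintro ⟨_, ⟨⟨g, γ⟩, rfl⟩, rfl⟩
    exact ⟨g, trivial, γ, (boundary_copy φ g γ).symm⟩
  · rintro ⟨g, -, γ, rfl⟩
    exact ⟨_, ⟨(g, γ), rfl⟩, boundary_copy φ g γ⟩

theorem finite [Finite Γ] [Finite G] : Finite (FreeNormalClosure φ) := by
  refine Subgroup.finite_of_ker_le_center (boundary φ) (ker_boundary_le_center φ)
    (Set.finite_range _) ?_ (closure_range_copy φ)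
  rintro _ ⟨⟨g, γ⟩, rfl⟩
  exact MonoidHom.isOfFinOrder _ (isOfFinOrder_of_finite γ)

section Lift

variable {φ} {M N : Type u} [Group M] [Group N] {n : N →* M} (c : NormalStructure n)
  (τ : G →* M) (ψ : Γ →* N)

/-- The homomorphism from the free product that underlies `lift`. -/
def preLift : Pre Γ G →* N :=
  Monoid.CoprodI.lift fun g : G => (c.act (τ g)).toMonoidHom.comp ψ

theorem preLift_translate (h : G) (y : Pre Γ G) :
    preLift c τ ψ (translate h y) = c.act (τ h) (preLift c τ ψ y) := by
  have : (preLift c τ ψ).comp (translate h) =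
      (c.act (τ h)).toMonoidHom.comp (preLift c τ ψ) := by
    refine Monoid.CoprodI.ext_hom _ _ fun g => ?_
    ext γ
    simp [preLift, translate, formalConj]
  exact DFunLike.congr_fun this y

theorem apply_preLift (h : n.comp ψ = τ.comp φ) (x : Pre Γ G) :
    n (preLift c τ ψ x) = τ (preBoundary φ x) := by
  have : n.comp (preLift c τ ψ) = τ.comp (preBoundary φ) := by
    refine Monoid.CoprodI.ext_hom _ _ fun g => ?_
    ext γ
    have := DFunLike.congr_fun h γ
    simp only [MonoidHom.comp_apply] at this
    simp [preLift, preBoundary, c.equivariant, this]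
  exact DFunLike.congr_fun this x

/-- The homomorphism from the free normal closure of `φ` to a crossed module `n : N →* M` induced
by a commutative square from `φ` to `n`. -/
def lift (h : n.comp ψ = τ.comp φ) : FreeNormalClosure φ →* N :=
  QuotientGroup.lift (Subgroup.normalClosure (peifferSet φ)) (preLift c τ ψ) <| by
    intro x hx
    refine Subgroup.normalClosure_le_normal (N := (preLift c τ ψ).ker) ?_ hx
    rintro _ ⟨x, y, rfl⟩
    change preLift c τ ψ _ = 1
    rw [map_mul, map_inv, preLift_translate, ← apply_preLift c τ ψ h, c.peiffer]
    simp

theorem lift_unit (h : n.comp ψ = τ.comp φ) (γ : Γ) : lift c τ ψ h (unit φ γ) = ψ γ := by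
  change preLift c τ ψ (formalConj 1 γ) = ψ γ
  simp [preLift, formalConj]

theorem apply_lift (h : n.comp ψ = τ.comp φ) (x : FreeNormalClosure φ) :
    n (lift c τ ψ h x) = τ (boundary φ x) := by
  obtain ⟨x, rfl⟩ := QuotientGroup.mk_surjective x
  exact apply_preLift c τ ψ h x

end Lift

end FreeNormalClosure

/-! ### Normal and subnormal maps. -/

section NormalMaps

theorem NormalStructure.ker_le_center {M G : Type u} [Group M] [Group G] {n : M →* G}
    (c : NormalStructure n) : n.ker ≤ Subgroup.center M := by
  intro z hz
  refine Subgroup.mem_center_iff.2 fun x => ?_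
  have h := c.peiffer z x
  rw [hz, map_one, MulAut.one_apply, eq_mul_inv_iff_mul_eq] at h
  exact h

/-- A central extension is a normal map. -/
theorem isNormalMap_of_surjective {M G : Type u} [Group M] [Group G] {n : M →* G}
    (hn : Function.Surjective n) (hker : n.ker ≤ Subgroup.center M) : IsNormalMap n := by
  -- An element of `G` acts by conjugation with any lift; centrality makes the choice irrelevant.
  have key : n.ker ≤ (MulAut.conj (G := M)).ker := by
    intro z hz
    rw [MonoidHom.mem_ker]
    ext x
    rw [MulAut.conj_apply, ← Subgroup.mem_center_iff.1 (hker hz) x]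
    simp
  have hact : ∀ m, n.liftOfSurjective hn ⟨MulAut.conj (G := M), key⟩ (n m) = MulAut.conj m :=
    fun m => n.liftOfRightInverse_comp_apply _ _ _ m
  refine ⟨⟨n.liftOfSurjective hn ⟨MulAut.conj (G := M), key⟩, ?_, ?_⟩⟩
  · intro g m
    obtain ⟨x, rfl⟩ := hn g
    rw [hact]
    simp
  · intro m m'
    rw [hact]
    simp

theorem isNormalMap_inclusion {G : Type u} [Group G] {H K : Subgroup G} (h : H ≤ K)
    (hconj : ∀ k ∈ K, ∀ x ∈ H, k * x * k⁻¹ ∈ H) : IsNormalMap (Subgroup.inclusion h) := by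
  have hN : (H.subgroupOf K).Normal := ⟨fun x hx k => hconj k k.2 x hx⟩
  let e : H.subgroupOf K ≃* H := Subgroup.subgroupOfEquivOfLe h
  refine ⟨⟨(MulAut.congr e).toMonoidHom.comp MulAut.conjNormal, ?_, ?_⟩⟩
  · intro g m
    rfl
  · intro m m'
    rfl

theorem IsSubnormalMap.of_surjective {M G : Type u} [Group M] [Group G] {n : M →* G}
    (hn : Function.Surjective n) (hker : n.ker ≤ Subgroup.center M) : IsSubnormalMap n :=
  (IsSubnormalMap.id (G := G)).comp _ _ (isNormalMap_of_surjective hn hker)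

/-- Two homomorphisms to `S` that agree after composition with a subnormal map agree if they agree
on a normally generating set. -/
theorem IsSubnormalMap.hom_ext {S G : Type u} [Group S] [Group G] {s : S →* G}
    (hs : IsSubnormalMap s) {D : Type u} [Group D] {X : Set D}
    (hX : Subgroup.normalClosure X = ⊤) {σ σ' : D →* S} (h : Set.EqOn σ σ' X)
    (hcomp : s.comp σ = s.comp σ') : σ = σ' := by
  induction hs with
  | id => exact hcomp
  | @comp M N _ _ m n _ hn ih =>
    have hnσ : n.comp σ = n.comp σ' := ih (fun x hx => congrArg n (h hx)) hcomp
    obtain ⟨c⟩ := hn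
    -- The values `σ g` and `σ' g` differ by a central element, so they conjugate alike and the
    -- equalizer is normal.
    have hz : ∀ g y, y * ((σ' g)⁻¹ * σ g) = ((σ' g)⁻¹ * σ g) * y := by
      intro g y
      refine Subgroup.mem_center_iff.1 (c.ker_le_center ?_) y
      have : n (σ g) = n (σ' g) := DFunLike.congr_fun hnσ g
      simp [MonoidHom.mem_ker, this]
    have hnormal : (σ.eqLocus σ').Normal := by
      refine ⟨fun x hx g => ?_⟩
      change σ (g * x * g⁻¹) = σ' (g * x * g⁻¹)
      have hx : σ x = σ' x := hx
      rw [map_mul, map_mul, map_mul, map_mul, map_inv, map_inv, hx]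
      calc σ g * σ' x * (σ g)⁻¹
          = σ' g * (((σ' g)⁻¹ * σ g) * σ' x) * (σ g)⁻¹ := by group
        _ = _ := by rw [← hz]; group
    have hle : Subgroup.normalClosure X ≤ σ.eqLocus σ' :=
      Subgroup.normalClosure_le_normal h
    ext x
    exact hle (hX ▸ Subgroup.mem_top x)

end NormalMaps

/-! ### Images in the tower and their stabilization. -/

namespace NormalClosuresTower

/-- In an inverse sequence of surjections every element extends to a compatible sequence. -/
theorem exists_section {X : ℕ → Type*} (d : ∀ i, X (i + 1) → X i)
    (hd : ∀ i, Function.Surjective (d i)) (n : ℕ) (a : X n) :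
    ∃ x : ∀ i, X i, (∀ i, d i (x (i + 1)) = x i) ∧ x n = a := by
  induction n generalizing X with
  | zero =>
    choose r hr using hd
    exact ⟨fun i => Nat.rec a (fun i y => r i y) i, fun i => hr i _, rfl⟩
  | succ n ih =>
    obtain ⟨y, hy, rfl⟩ := ih (X := fun i => X (i + 1)) (fun i => d (i + 1)) (fun i => hd (i + 1)) a
    refine ⟨fun i => Nat.casesOn i (d 0 (y 0)) y, ?_, rfl⟩
    rintro (_ | i)
    · rfl
    · exact hy i

variable {Γ G : Type u} [Group Γ] [Group G] (φ : Γ →* G)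

theorem finite_stage [Finite Γ] [Finite G] (i : ℕ) : Finite (stage φ i).carrier := by
  induction i with
  | zero => assumption
  | succ i ih => exact FreeNormalClosure.finite (stage φ i).hom

theorem down_comp_hom (i : ℕ) : (down φ i).comp (stage φ (i + 1)).hom = (stage φ i).hom :=
  MonoidHom.ext fun γ => FreeNormalClosure.boundary_unit (stage φ i).hom γ

/-- The image in the stage `i` of the stage `i + j`. -/
def image : ℕ → ∀ i, Subgroup (stage φ i).carrier
  | 0, _ => ⊤
  | j + 1, i => (image j (i + 1)).map (down φ i)

/-- The case `j = 0` is `range_boundary`, and `down` carries it to lower stages. Consequently each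
image is normal in the preceding one, and a stable image is normally generated by `Γ`. -/
theorem image_succ_eq_conjClosure (j i : ℕ) :
    image φ (j + 1) i = Subgroup.conjClosure (stage φ i).hom (image φ j i) := by
  induction j generalizing i with
  | zero =>
    exact (MonoidHom.range_eq_map _).symm.trans (FreeNormalClosure.range_boundary (stage φ i).hom)
  | succ j ih =>
    change (image φ (j + 1) (i + 1)).map (down φ i) = _
    rw [ih, Subgroup.map_conjClosure, down_comp_hom]
    rfl

theorem image_antitone (i : ℕ) : Antitone fun j => image φ j i := by
  refine antitone_nat_of_succ_le fun j => ?_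
  induction j generalizing i with
  | zero => exact le_top
  | succ j ih => exact Subgroup.map_mono (ih (i + 1))

/-- The stable image in the stage `i` of the stages above it. -/
def stableImage (i : ℕ) : Subgroup (stage φ i).carrier := ⨅ j, image φ j i

theorem coe_apply_mem_stableImage (x : limit φ) (i : ℕ) :
    (x : ∀ i, (stage φ i).carrier) i ∈ stableImage φ i := by
  refine Subgroup.mem_iInf.2 fun j => ?_
  induction j generalizing i with
  | zero => trivial
  | succ j ih => exact ⟨_, ih (i + 1), x.2 i⟩

theorem isSubnormalMap_image_subtype (j : ℕ) :
    IsSubnormalMap (image φ j 0 : Subgroup G).subtype := by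
  induction j with
  | zero =>
    -- The inclusion of `⊤` is an isomorphism but not literally the identity, so it counts as a
    -- central extension.
    refine IsSubnormalMap.of_surjective (fun x => ⟨⟨x, trivial⟩, rfl⟩) ?_
    intro x hx
    have : x = 1 := Subtype.ext hx
    exact this ▸ one_mem _
  | succ j ih =>
    refine ih.comp _ (Subgroup.inclusion (image_antitone φ 0 j.le_succ))
      (isNormalMap_inclusion _ fun k hk x hx => ?_)
    change x ∈ image φ (j + 1) 0 at hx
    change k * x * k⁻¹ ∈ image φ (j + 1) 0
    rw [image_succ_eq_conjClosure] at hx ⊢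
    exact Subgroup.conj_mem_of_mem_conjClosure _ hk hx

/-! ### Finite groups: the limit is a stable image. -/

section Finite

variable [Finite Γ] [Finite G]

theorem exists_stableImage_eq (i : ℕ) :
    ∃ n, ∀ m, n ≤ m → image φ m i = stableImage φ i := by
  have := finite_stage φ i
  obtain ⟨n, hn⟩ := Subgroup.exists_antitone_eventually_eq (image_antitone φ i)
  have : stableImage φ i = image φ n i := by
    refine le_antisymm (iInf_le _ n) (le_iInf fun j => ?_)
    rcases le_total n j with h | h
    · exact (hn j h).ge
    · exact image_antitone φ i h
  exact ⟨n, fun m hm => (hn m hm).trans this.symm⟩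

theorem map_stableImage (i : ℕ) : (stableImage φ (i + 1)).map (down φ i) = stableImage φ i := by
  obtain ⟨n, hn⟩ := exists_stableImage_eq φ i
  obtain ⟨n', hn'⟩ := exists_stableImage_eq φ (i + 1)
  -- Image `m + 1` in stage `i` is by definition the image of image `m` in stage `i + 1`; take `m`
  -- beyond both stabilization points.
  rw [← hn (max n n' + 1) (by omega), ← hn' (max n n') (by omega)]
  rfl

theorem stableImage_eq_conjClosure (i : ℕ) :
    stableImage φ i = Subgroup.conjClosure (stage φ i).hom (stableImage φ i) := by
  obtain ⟨n, hn⟩ := exists_stableImage_eq φ i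
  conv_lhs => rw [← hn (n + 1) n.le_succ, image_succ_eq_conjClosure, hn n le_rfl]

/-- The map between consecutive stable images. -/
def stableDown (i : ℕ) : stableImage φ (i + 1) →* stableImage φ i :=
  ((down φ i).comp (stableImage φ (i + 1)).subtype).codRestrict (stableImage φ i) fun x =>
    map_stableImage φ i ▸ ⟨x, x.2, rfl⟩

theorem stableDown_surjective (i : ℕ) : Function.Surjective (stableDown φ i) := by
  rintro ⟨y, hy⟩
  rw [← map_stableImage] at hy
  obtain ⟨x, hx, rfl⟩ := hy
  exact ⟨⟨x, hx⟩, rfl⟩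

theorem ker_stableDown_le_center (i : ℕ) :
    (stableDown φ i).ker ≤ Subgroup.center (stableImage φ (i + 1)) := by
  intro x hx
  refine Subgroup.mem_center_iff.2 fun y => Subtype.ext ?_
  have hx : down φ i x = 1 := congrArg Subtype.val hx
  exact Subgroup.mem_center_iff.1 (FreeNormalClosure.ker_boundary_le_center _ hx) y.1

theorem hom_mem_stableImage (i : ℕ) (γ : Γ) : (stage φ i).hom γ ∈ stableImage φ i := by
  rw [stableImage_eq_conjClosure]
  simpa using Subgroup.conj_mem_conjClosure (stage φ i).hom (one_mem (stableImage φ i)) γ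

/-- The map from `Γ` to the stable image. -/
def toStableImage (i : ℕ) : Γ →* stableImage φ i :=
  (stage φ i).hom.codRestrict (stableImage φ i) (hom_mem_stableImage φ i)

theorem normalClosure_range_toStableImage (i : ℕ) :
    Subgroup.normalClosure (Set.range (toStableImage φ i)) = ⊤ := by
  have hle : Subgroup.conjClosure (stage φ i).hom (stableImage φ i) ≤
      (Subgroup.normalClosure (Set.range (toStableImage φ i))).map (stableImage φ i).subtype := by
    refine (Subgroup.closure_le _).2 ?_
    rintro _ ⟨a, ha, γ, rfl⟩
    refine ⟨⟨a, ha⟩ * toStableImage φ i γ * ⟨a, ha⟩⁻¹, ?_, rfl⟩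
    exact Subgroup.normalClosure_normal.conj_mem _
      (Subgroup.subset_normalClosure (Set.mem_range_self γ)) _
  rw [← stableImage_eq_conjClosure] at hle
  refine eq_top_iff.2 fun x _ => ?_
  obtain ⟨y, hy, hxy⟩ := hle x.2
  have : y = x := Subtype.ext hxy
  exact this ▸ hy

/-- Each step up is a central extension, which the next upper central term absorbs, so the index
never grows. At the bottom it is the order of a subgroup of `G`. -/
theorem index_upperCentralSeries_stableImage_le (i : ℕ) :
    (Subgroup.upperCentralSeries (stableImage φ i) i).index ≤ Nat.card G := by
  have := finite_stage φ
  induction i with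
  | zero =>
    rw [Subgroup.upperCentralSeries_zero, Subgroup.index_bot]
    exact Subgroup.card_le_card_group (stableImage φ 0 : Subgroup G)
  | succ i ih =>
    refine le_trans ?_ ih
    rw [← Subgroup.index_comap_of_surjective _ (stableDown_surjective φ i)]
    exact Subgroup.index_antitone
      (Subgroup.comap_upperCentralSeries_le (ker_stableDown_le_center φ i) i)

theorem exists_card_stableImage_le : ∃ B, ∀ i, Nat.card (stableImage φ i) ≤ B := by
  have := finite_stage φ
  let F : ℕ → ℕ := fun m =>
    Nat.card Γ * (m ^ (m * (m * m) + 1) * m ^ (Nat.card Γ * (m * Nat.card Γ)))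
  -- The index varies with `i` but takes only values up to `|G|`, so a supremum over these suffices.
  refine ⟨(Finset.range (Nat.card G + 1)).sup F, fun i => ?_⟩
  refine (Subgroup.card_le_of_normalClosure_range_eq_top (toStableImage φ i)
    (normalClosure_range_toStableImage φ i) (k := i) rfl).trans ?_
  exact Finset.le_sup (f := F) (Finset.mem_range_succ_iff.2
    (index_upperCentralSeries_stableImage_le φ i))

/-- The orders are nondecreasing and bounded, hence eventually constant. -/
theorem exists_stableDown_injective : ∃ n, ∀ i, n ≤ i → Function.Injective (stableDown φ i) := by
  have := finite_stage φ
  obtain ⟨B, hB⟩ := exists_card_stableImage_le φ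
  have hmono : Monotone fun i => Nat.card (stableImage φ i) :=
    monotone_nat_of_le_succ fun i => Nat.card_le_card_of_surjective _ (stableDown_surjective φ i)
  obtain ⟨n, hn⟩ : ∃ n, ∀ i, Nat.card (stableImage φ i) ≤ Nat.card (stableImage φ n) := by
    have hfin : (Set.range fun i => Nat.card (stableImage φ i)).Finite :=
      (Set.finite_Iic B).subset (by rintro _ ⟨i, rfl⟩; exact hB i)
    obtain ⟨_, ⟨n, rfl⟩, hn⟩ := Set.exists_max_image _ id hfin ⟨_, 0, rfl⟩
    exact ⟨n, fun i => hn _ ⟨i, rfl⟩⟩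
  refine ⟨n, fun i hi => ?_⟩
  refine ((Nat.bijective_iff_surjective_and_card _).2 ⟨stableDown_surjective φ i, ?_⟩).1
  exact le_antisymm ((hn _).trans (hmono hi)) (hmono i.le_succ)

/-- The projection of the limit to the stable image. -/
def proj (i : ℕ) : limit φ →* stableImage φ i :=
  ((Pi.evalMonoidHom (fun i => (stage φ i).carrier) i).comp (limit φ).subtype).codRestrict
    (stableImage φ i) fun x => coe_apply_mem_stableImage φ x i

theorem stableDown_proj (i : ℕ) (x : limit φ) : stableDown φ i (proj φ (i + 1) x) = proj φ i x :=
  Subtype.ext (x.2 i)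

theorem proj_surjective (i : ℕ) : Function.Surjective (proj φ i) := by
  intro a
  obtain ⟨x, hx, rfl⟩ := exists_section (X := fun i => stableImage φ i)
    (fun i => stableDown φ i) (stableDown_surjective φ) i a
  exact ⟨⟨fun i => x i, fun i => congrArg Subtype.val (hx i)⟩, rfl⟩

theorem exists_proj_injective : ∃ n, Function.Injective (proj φ n) := by
  obtain ⟨n, hn⟩ := exists_stableDown_injective φ
  refine ⟨n, (injective_iff_map_eq_one _).2 fun x hx => ?_⟩
  have hup : ∀ i, n ≤ i → proj φ i x = 1 := by
    intro i hi
    induction i, hi using Nat.le_induction with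
    | base => exact hx
    | succ i hi ih =>
      refine hn i hi ?_
      rw [stableDown_proj, ih, map_one]
  have hstep : ∀ k i, proj φ (i + k) x = 1 → proj φ i x = 1 := by
    intro k
    induction k with
    | zero => exact fun i h => h
    | succ k ih =>
      intro i h
      refine ih i ?_
      rw [← stableDown_proj]
      exact (congrArg _ h).trans (map_one _)
  refine Subtype.ext (funext fun i => ?_)
  -- Climbing to `i + n ≥ n` and descending `n` steps covers every `i` without comparing it to `n`.
  exact congrArg Subtype.val (hstep n i (hup _ (by omega)))

theorem normalClosure_range_toLimit :
    Subgroup.normalClosure (Set.range (toLimit φ)) = ⊤ := by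
  obtain ⟨n, hn⟩ := exists_proj_injective φ
  refine Subgroup.map_injective hn ?_
  rw [Subgroup.map_normalClosure _ _ (proj_surjective φ n),
    Subgroup.map_top_of_surjective _ (proj_surjective φ n), ← Set.range_comp]
  exact normalClosure_range_toStableImage φ n

/-- The homomorphism from the stable image to the bottom of the tower. -/
def stableBottom : ∀ i, stableImage φ i →* G
  | 0 => (stableImage φ 0 : Subgroup G).subtype
  | i + 1 => (stableBottom i).comp (stableDown φ i)

theorem isSubnormalMap_stableBottom (i : ℕ) : IsSubnormalMap (stableBottom φ i) := by
  induction i with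
  | zero =>
    obtain ⟨n, hn⟩ := exists_stableImage_eq φ 0
    have := isSubnormalMap_image_subtype φ n
    rw [hn n le_rfl] at this
    exact this
  | succ i ih =>
    exact ih.comp _ _
      (isNormalMap_of_surjective (stableDown_surjective φ i) (ker_stableDown_le_center φ i))

theorem stableBottom_comp_proj (i : ℕ) : (stableBottom φ i).comp (proj φ i) = fromLimit φ := by
  induction i with
  | zero => rfl
  | succ i ih =>
    rw [← ih]
    ext x
    exact congrArg (stableBottom φ i) (stableDown_proj φ i x)

theorem isSubnormalMap_fromLimit : IsSubnormalMap (fromLimit φ) := by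
  obtain ⟨n, hn⟩ := exists_proj_injective φ
  rw [← stableBottom_comp_proj φ n]
  refine (isSubnormalMap_stableBottom φ n).comp _ _
    (isNormalMap_of_surjective (proj_surjective φ n) ?_)
  rw [(MonoidHom.ker_eq_bot_iff _).2 hn]
  exact bot_le

end Finite

/-- Each normal map in the series for `s` is lifted through at the cost of one more stage, by the
universal property of the free normal closure. -/
theorem exists_hom_of_isSubnormalMap {S : Type u} [Group S] {s : S →* G}
    (hs : IsSubnormalMap s) (ψ : Γ →* S) (h : s.comp ψ = φ) :
    ∃ (k : ℕ) (τ : (stage φ k).carrier →* S), τ.comp (stage φ k).hom = ψ ∧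
      ∀ x : limit φ, s (τ ((x : ∀ i, (stage φ i).carrier) k)) = fromLimit φ x := by
  induction hs with
  | id => exact ⟨0, MonoidHom.id G, h.symm, fun x => rfl⟩
  | @comp M N _ _ m n _ hn ih =>
    obtain ⟨k, τ, hτ, hx⟩ := ih (n.comp ψ) h
    obtain ⟨c⟩ := hn
    refine ⟨k + 1, FreeNormalClosure.lift c τ ψ hτ.symm, ?_, fun x => ?_⟩
    · ext γ
      exact FreeNormalClosure.lift_unit c τ ψ hτ.symm γ
    · rw [← hx x, MonoidHom.comp_apply]
      refine congrArg m ((FreeNormalClosure.apply_lift c τ ψ hτ.symm _).trans ?_)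
      exact congrArg τ (x.2 k)

end NormalClosuresTower

/-- For finite `Γ` and `G`, `Γ → Γ_∞ → G` is initial among the factorizations of `φ : Γ →* G`
whose second map is subnormal: it is such a factorization, and it maps uniquely to every such
factorization `Γ → S → G`. -/
theorem mainTheorem2 {Γ G : Type u} [Group Γ] [Group G] [Finite Γ] [Finite G] (φ : Γ →* G) :
    ((NormalClosuresTower.fromLimit φ).comp (NormalClosuresTower.toLimit φ) = φ ∧
      IsSubnormalMap (NormalClosuresTower.fromLimit φ)) ∧
    ∀ (S : Type u) [Group S] (ψ : Γ →* S) (s : S →* G),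
      s.comp ψ = φ → IsSubnormalMap s →
        ∃! σ : NormalClosuresTower.limit φ →* S,
          σ.comp (NormalClosuresTower.toLimit φ) = ψ ∧
            s.comp σ = NormalClosuresTower.fromLimit φ := by
  refine ⟨⟨rfl, NormalClosuresTower.isSubnormalMap_fromLimit φ⟩, fun S _ ψ s hψ hs => ?_⟩
  obtain ⟨k, τ, hτ, hx⟩ := NormalClosuresTower.exists_hom_of_isSubnormalMap φ hs ψ hψ
  refine ⟨τ.comp ((Pi.evalMonoidHom _ k).comp (NormalClosuresTower.limit φ).subtype),
    ⟨hτ, MonoidHom.ext hx⟩, ?_⟩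
  rintro σ ⟨hσ, hsσ⟩
  -- Both candidates agree over `G` and on the image of `Γ`, which normally generates the limit.
  refine hs.hom_ext (NormalClosuresTower.normalClosure_range_toLimit φ) ?_
    (hsσ.trans (MonoidHom.ext hx).symm)
  rintro _ ⟨γ, rfl⟩
  exact (DFunLike.congr_fun hσ γ).trans (DFunLike.congr_fun hτ γ).symm
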